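/- Let $H$ be a complex Hilbert space and, for a bounded operator $S$ on a Hilbert space, write $[S^*,S]=S^*S-SS^*$ for its self-commutator. A bounded operator $X$ is called trace class if $X$ is compact and the eigenvalues of $(X^*X)^{1/2}$, counted with multiplicity, are summable. Let $T$ be a bounded operator on $H$ in the class $\mathcal A_1$, that is, $[T^*,T]=P+C$ for some positive (i.e. positive semidefinite) bounded operator $P$ and some trace-class operator $C$ on $H$. Let $V\subseteq H$ be a closed subspace with $TV\subseteq V$, and suppose that $V$ is the closed linear span of the generalized eigenvectors of $T|_V$, that is, of the nonzero vectors $f\in V$ such that $(T|_V-\mu)^k f=0$ for some $\mu\in\mathbb C$ and some $k\in\mathbb N$. Then the self-commutator $[(T|_V)^*,T|_V]$, where $T|_V$ is regarded as an operator on the Hilbert space $V$, is trace class. -/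

import Mathlib

/-- The self-commutator `[T*, T] = T* T - T T*` of a bounded operator on a Hilbert space. -/
noncomputable def selfCommutator {H : Type*} [NormedAddCommGroup H] [InnerProductSpace ℂ H]
    [CompleteSpace H] (T : H →L[ℂ] H) : H →L[ℂ] H :=
  ContinuousLinearMap.adjoint T * T - T * ContinuousLinearMap.adjoint T

/-- `X` is trace class: `X` is compact and the eigenvalues of `|X| = (X* X)^{1/2}`, counted with
multiplicity, are summable. The real number `s` is counted as often as the dimension of the
eigenspace of `|X|` at `s`: this is `0` when `s` is not an eigenvalue, and finite for `s ≠ 0`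
because `X` is compact; the eigenvalue `0` contributes nothing. -/
def IsTraceClass {H : Type*} [NormedAddCommGroup H] [InnerProductSpace ℂ H]
    [CompleteSpace H] (X : H →L[ℂ] H) : Prop :=
  IsCompactOperator X ∧
    Summable fun s : ℝ =>
      (Module.finrank ℂ
        (Module.End.eigenspace (CFC.abs X : H →L[ℂ] H).toLinearMap (s : ℂ)) : ℝ) * s

/-- The class `A_1`: the self-commutator is the sum of a positive operator and a trace-class
operator. -/
def IsClassAOne {H : Type*} [NormedAddCommGroup H] [InnerProductSpace ℂ H]
    [CompleteSpace H] (T : H →L[ℂ] H) : Prop :=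
  ∃ P C : H →L[ℂ] H, P.IsPositive ∧ IsTraceClass C ∧ selfCommutator T = P + C

/-- `f` is a generalized eigenvector of `S`: it is nonzero and `(S - μ)^k f = 0` for some complex
number `μ` and some natural number `k`. -/
def IsGeneralizedEigenvector {E : Type*} [NormedAddCommGroup E] [NormedSpace ℂ E]
    (S : E →L[ℂ] E) (f : E) : Prop :=
  f ≠ 0 ∧ ∃ (μ : ℂ) (k : ℕ), ((S - μ • (1 : E →L[ℂ] E)) ^ k) f = 0

/-!
The restriction `S = T|_V` inherits the hypothesis on `T`: with `J` the inclusion of `V`,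
`[S*, S] = J* [T*, T] J + J* T (1 - J J*) T* J` (`selfCommutator_restrict`), so `[S*, S] = P + C`
with `P` positive and `C` trace class on `V`. It remains to see that `P` is trace class.

On a finite-dimensional `S`-invariant subspace `F` the trace of the compression of `[S*, S]` is
nonpositive (`sum_re_inner_selfCommutator_nonpos`): it is the squared Hilbert-Schmidt norm of
`S|_F`, which takes values in `F`, minus that of `S*|_F`, which need not. Hence the trace of the
compression of `P` to `F` is at most the trace norm of `C`. Each generalized eigenvector lies in
such an `F`, so these subspaces form a directed family with dense union, and the projections onto
them converge strongly to the identity. Thus `∑ ⟪P e_i, e_i⟫` is bounded by the trace norm of `C`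
for every orthonormal family (`isTraceClass_selfCommutator_of_eq_add`).

To pass between this bound and the definition of trace class by eigenvalues, the trace norm is
described as the supremum of `∑ |⟪e_i, X f_i⟫|` over finite orthonormal families, a description
under which sums and compressions are immediate. One direction
(`IsTraceClass.exists_hasTraceNormLE`) is the spectral theorem for the compact operator `|X|`
together with Bessel's inequality. For the other (`HasTraceNormLE.isTraceClass`), eigenvectors of
`|X|` and their images under `X` serve as test families, and compactness follows because a
noncompact `X` has arbitrarily long orthonormal families with matrix entries bounded below.
-/

open scoped InnerProductSpace
open Filter Topology

/-! ### The absolute value of an operator -/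

section AbsoluteValue

variable {H : Type*} [NormedAddCommGroup H] [InnerProductSpace ℂ H] [CompleteSpace H]

lemma isPositive_cfcAbs (X : H →L[ℂ] H) : (CFC.abs X : H →L[ℂ] H).IsPositive :=
  (ContinuousLinearMap.nonneg_iff_isPositive _).1 (CFC.abs_nonneg X)

lemma inner_cfcAbs_apply_cfcAbs_apply (X : H →L[ℂ] H) (x y : H) :
    ⟪(CFC.abs X : H →L[ℂ] H) x, (CFC.abs X : H →L[ℂ] H) y⟫_ℂ = ⟪X x, X y⟫_ℂ := by
  have h : (CFC.abs X : H →L[ℂ] H) ((CFC.abs X : H →L[ℂ] H) y)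
      = ContinuousLinearMap.adjoint X (X y) :=
    congrArg (fun A : H →L[ℂ] H => A y) (CFC.abs_mul_abs X)
  rw [(isPositive_cfcAbs X).inner_left_eq_inner_right, h,
    ContinuousLinearMap.adjoint_inner_right]

lemma norm_cfcAbs_apply (X : H →L[ℂ] H) (x : H) : ‖(CFC.abs X : H →L[ℂ] H) x‖ = ‖X x‖ := by
  rw [@norm_eq_sqrt_re_inner ℂ, @norm_eq_sqrt_re_inner ℂ, inner_cfcAbs_apply_cfcAbs_apply]

/-- An operator dominated in norm, vector by vector, by a compact one is compact: a finite net of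
the image of the ball under the larger operator yields a net for the smaller one. -/
lemma IsCompactOperator.of_norm_apply_le {X Y : H →L[ℂ] H} (hX : IsCompactOperator X)
    (h : ∀ x, ‖Y x‖ ≤ ‖X x‖) : IsCompactOperator Y := by
  have hXb : TotallyBounded (X '' Metric.ball 0 1) :=
    ((hX : IsCompactOperator (X : H →ₗ[ℂ] H)).isCompact_closure_image_ball 1).totallyBounded.subset
      subset_closure
  refine (isCompactOperator_iff_isCompact_closure_image_ball (Y : H →ₗ[ℂ] H) one_pos).2 ?_
  refine TotallyBounded.isCompact_of_isClosed (TotallyBounded.closure ?_) isClosed_closure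
  rw [Metric.totallyBounded_iff]
  intro ε hε
  obtain ⟨u, -, huf, ht⟩ := Set.exists_subset_image_finite_and.1
    (totallyBounded_iff_subset.1 hXb _ (Metric.dist_mem_uniformity hε))
  refine ⟨Y '' u, huf.image _, ?_⟩
  rintro _ ⟨x, hx, rfl⟩
  obtain ⟨_, ⟨y, hy, rfl⟩, hxy⟩ := Set.mem_iUnion₂.1 (ht ⟨x, hx, rfl⟩)
  refine Set.mem_iUnion₂.2 ⟨Y y, ⟨y, hy, rfl⟩, ?_⟩
  have hxy' : dist (X x) (X y) < ε := hxy
  rw [dist_eq_norm, ← map_sub] at hxy'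
  rw [Metric.mem_ball, dist_eq_norm]
  exact lt_of_le_of_lt (by simpa using h (x - y)) hxy'

lemma IsCompactOperator.cfcAbs {X : H →L[ℂ] H} (hX : IsCompactOperator X) :
    IsCompactOperator (CFC.abs X : H →L[ℂ] H) :=
  hX.of_norm_apply_le fun x => (norm_cfcAbs_apply X x).le

lemma eigenspace_cfcAbs_eq_bot_of_neg (X : H →L[ℂ] H) {s : ℝ} (hs : s < 0) :
    Module.End.eigenspace (CFC.abs X : H →L[ℂ] H).toLinearMap (s : ℂ) = ⊥ := by
  by_contra h
  exact hs.not_ge (eigenvalue_nonneg_of_nonneg (𝕜 := ℂ) (μ := s) (Module.End.hasEigenvalue_iff.2 h)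
    fun x => (isPositive_cfcAbs X).re_inner_nonneg_right x)

/-- The multiplicity-weighted eigenvalues of `|X|` are nonnegative. -/
lemma finrank_eigenspace_cfcAbs_mul_nonneg (X : H →L[ℂ] H) (s : ℝ) :
    0 ≤ (Module.finrank ℂ
      (Module.End.eigenspace (CFC.abs X : H →L[ℂ] H).toLinearMap (s : ℂ)) : ℝ) * s := by
  rcases lt_or_ge s 0 with hs | hs
  · rw [eigenspace_cfcAbs_eq_bot_of_neg X hs, finrank_bot, Nat.cast_zero, zero_mul]
  · positivity

lemma norm_apply_of_mem_eigenspace_cfcAbs {X : H →L[ℂ] H} {s : ℝ} (hs : 0 ≤ s) {x : H}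
    (hx : x ∈ Module.End.eigenspace (CFC.abs X : H →L[ℂ] H).toLinearMap (s : ℂ)) :
    ‖X x‖ = s * ‖x‖ := by
  have h : (CFC.abs X : H →L[ℂ] H) x = (s : ℂ) • x := Module.End.mem_eigenspace_iff.1 hx
  rw [← norm_cfcAbs_apply, h, norm_smul, Complex.norm_real, Real.norm_of_nonneg hs]

lemma orthogonalFamily_eigenspace_cfcAbs (X : H →L[ℂ] H) :
    OrthogonalFamily ℂ
      (fun s : ℝ => Module.End.eigenspace (CFC.abs X : H →L[ℂ] H).toLinearMap (s : ℂ))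
      fun s => (Module.End.eigenspace (CFC.abs X : H →L[ℂ] H).toLinearMap (s : ℂ)).subtypeₗᵢ :=
  (isPositive_cfcAbs X).isSymmetric.orthogonalFamily_eigenspaces.comp Complex.ofReal_injective

/-- Spectral theorem: for compact `X`, every vector is a convergent sum of eigenvectors of `|X|`,
taken over the real numbers. -/
lemma IsCompactOperator.exists_hasSum_eigenspace_cfcAbs {X : H →L[ℂ] H} (hX : IsCompactOperator X)
    (x : H) : ∃ w : ℝ → H,
      (∀ s : ℝ, w s ∈ Module.End.eigenspace (CFC.abs X : H →L[ℂ] H).toLinearMap (s : ℂ)) ∧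
        HasSum w x := by
  have hsymm := (isPositive_cfcAbs X).isSymmetric
  have hclosed (s : ℝ) :
      CompleteSpace (Module.End.eigenspace (CFC.abs X : H →L[ℂ] H).toLinearMap (s : ℂ)) := by
    refine IsClosed.completeSpace_coe (hs := ?_)
    have : (Module.End.eigenspace (CFC.abs X : H →L[ℂ] H).toLinearMap (s : ℂ) : Set H)
        = {x | (CFC.abs X : H →L[ℂ] H) x = (s : ℂ) • x} := by
      ext x; exact Module.End.mem_eigenspace_iff
    rw [this]
    exact isClosed_eq (ContinuousLinearMap.continuous _) (continuous_const_smul _)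
  have hle : (⨆ μ : ℂ, Module.End.eigenspace (CFC.abs X : H →L[ℂ] H).toLinearMap μ)
      ≤ ⨆ s : ℝ, Module.End.eigenspace (CFC.abs X : H →L[ℂ] H).toLinearMap (s : ℂ) := by
    refine iSup_le fun μ => ?_
    by_cases hμ : Module.End.HasEigenvalue (CFC.abs X : H →L[ℂ] H).toLinearMap μ
    · rw [← Complex.conj_eq_iff_re.1 (hsymm.conj_eigenvalue_eq_self hμ)]
      exact le_iSup (fun s : ℝ =>
        Module.End.eigenspace (CFC.abs X : H →L[ℂ] H).toLinearMap (s : ℂ)) μ.re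
    · rw [not_not.1 (mt Module.End.hasEigenvalue_iff.2 hμ)]
      exact bot_le
  have htop : ⊤ ≤ (⨆ s : ℝ,
      Module.End.eigenspace (CFC.abs X : H →L[ℂ] H).toLinearMap (s : ℂ)).topologicalClosure := by
    rw [top_le_iff, Submodule.topologicalClosure_eq_top_iff, eq_bot_iff,
      ← ContinuousLinearMap.orthogonalComplement_iSup_eigenspaces_eq_bot hX.cfcAbs hsymm]
    exact Submodule.orthogonal_le hle
  have hsum := IsHilbertSum.mkInternal _ (orthogonalFamily_eigenspace_cfcAbs X) htop
  obtain ⟨f, rfl⟩ := hsum.surjective_isometry x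
  exact ⟨fun s => f s, fun s => (f s).2, hsum.OrthogonalFamily.hasSum_linearIsometry f⟩

end AbsoluteValue

/-! ### Trace class in terms of orthonormal families -/

/-- The matrix entries of `X` between two finite orthonormal families have absolute values summing
to at most `M`. The least such `M` is the trace norm of `X`; indexing by types in `Type` loses
nothing, since the index types are finite. -/
def HasTraceNormLE {H : Type*} [NormedAddCommGroup H] [InnerProductSpace ℂ H]
    (X : H →L[ℂ] H) (M : ℝ) : Prop :=
  ∀ (ι : Type) [Fintype ι] (e f : ι → H), Orthonormal ℂ e → Orthonormal ℂ f →
    ∑ i, ‖⟪e i, X (f i)⟫_ℂ‖ ≤ M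

section TraceNorm

variable {H : Type*} [NormedAddCommGroup H] [InnerProductSpace ℂ H]

lemma HasTraceNormLE.add {X Y : H →L[ℂ] H} {M N : ℝ} (hX : HasTraceNormLE X M)
    (hY : HasTraceNormLE Y N) : HasTraceNormLE (X + Y) (M + N) := by
  intro ι _ e f he hf
  refine le_trans ?_ (add_le_add (hX ι e f he hf) (hY ι e f he hf))
  rw [← Finset.sum_add_distrib]
  gcongr with i
  rw [add_apply, inner_add_right]
  exact norm_add_le _ _

lemma Orthonormal.sum_norm_inner_mul_norm_inner_le {ι : Type*} [Fintype ι] {e f : ι → H}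
    (he : Orthonormal ℂ e) (hf : Orthonormal ℂ f) (x y : H) :
    ∑ i, ‖⟪e i, x⟫_ℂ‖ * ‖⟪f i, y⟫_ℂ‖ ≤ ‖x‖ * ‖y‖ := by
  refine abs_le_of_sq_le_sq' ?_ (by positivity) |>.2
  calc (∑ i, ‖⟪e i, x⟫_ℂ‖ * ‖⟪f i, y⟫_ℂ‖) ^ 2
      ≤ (∑ i, ‖⟪e i, x⟫_ℂ‖ ^ 2) * ∑ i, ‖⟪f i, y⟫_ℂ‖ ^ 2 :=
        Finset.sum_mul_sq_le_sq_mul_sq _ _ _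
    _ ≤ ‖x‖ ^ 2 * ‖y‖ ^ 2 := by
        gcongr
        · exact he.sum_inner_products_le x
        · exact hf.sum_inner_products_le y
    _ = (‖x‖ * ‖y‖) ^ 2 := by ring

/-- For a positive operator the diagonal entries control all of them, because
`|⟪e, P f⟫| ≤ (⟪P e, e⟫ + ⟪P f, f⟫) / 2`. -/
lemma ContinuousLinearMap.IsPositive.hasTraceNormLE {P : H →L[ℂ] H} (hP : P.IsPositive) {M : ℝ}
    (h : ∀ (ι : Type) [Fintype ι] (e : ι → H), Orthonormal ℂ e →
      ∑ i, (⟪P (e i), e i⟫_ℂ).re ≤ M) : HasTraceNormLE P M := by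
  have key (x y : H) : ‖⟪x, P y⟫_ℂ‖ ≤ ((⟪P x, x⟫_ℂ).re + (⟪P y, y⟫_ℂ).re) / 2 := by
    -- rotate `y` by a unit scalar `c` that makes `⟪x, P y⟫` real and nonpositive
    obtain ⟨c, hc, hcxy⟩ : ∃ c : ℂ, ‖c‖ = 1 ∧ c * ⟪x, P y⟫_ℂ = -‖⟪x, P y⟫_ℂ‖ := by
      by_cases h0 : ⟪x, P y⟫_ℂ = 0
      · exact ⟨1, by simp [h0]⟩
      · have h0' : (‖⟪x, P y⟫_ℂ‖ : ℂ) ≠ 0 := by simpa using h0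
        refine ⟨-‖⟪x, P y⟫_ℂ‖ / ⟪x, P y⟫_ℂ, ?_, ?_⟩
        · rw [norm_div, norm_neg, Complex.norm_real, norm_norm, div_self (norm_ne_zero_iff.2 h0)]
        · field_simp
    have hpos := hP.re_inner_nonneg_left (x + c • y)
    have h1 : ⟪P x, c • y⟫_ℂ = c * ⟪x, P y⟫_ℂ := by
      rw [inner_smul_right, hP.inner_left_eq_inner_right]
    have h2 : ⟪c • P y, x⟫_ℂ = starRingEnd ℂ (c * ⟪x, P y⟫_ℂ) := by
      rw [inner_smul_left, ← inner_conj_symm, map_mul]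
    have h3 : ⟪c • P y, c • y⟫_ℂ = ⟪P y, y⟫_ℂ := by
      rw [inner_smul_left, inner_smul_right, ← mul_assoc, ← Complex.normSq_eq_conj_mul_self,
        Complex.normSq_eq_norm_sq, hc]
      simp
    rw [map_add, map_smul, inner_add_left, inner_add_right, inner_add_right, h1, h2, h3, hcxy]
      at hpos
    simp only [RCLike.re_to_complex, Complex.add_re, map_neg, Complex.neg_re, Complex.conj_ofReal,
      Complex.ofReal_re] at hpos
    linarith
  intro ι _ e f he hf
  calc ∑ i, ‖⟪e i, P (f i)⟫_ℂ‖
      ≤ ∑ i, ((⟪P (e i), e i⟫_ℂ).re + (⟪P (f i), f i⟫_ℂ).re) / 2 :=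
        Finset.sum_le_sum fun i _ => key _ _
    _ = (∑ i, (⟪P (e i), e i⟫_ℂ).re + ∑ i, (⟪P (f i), f i⟫_ℂ).re) / 2 := by
        rw [← Finset.sum_add_distrib, Finset.sum_div]
    _ ≤ M := by linarith [h ι e he, h ι f hf]

variable [CompleteSpace H]

/-- Expanding the second family along eigenvectors of `|X|`, Bessel's inequality bounds the
contribution of an eigenspace by its dimension times its eigenvalue. -/
lemma IsTraceClass.exists_hasTraceNormLE {X : H →L[ℂ] H} (hX : IsTraceClass X) :
    ∃ M, HasTraceNormLE X M := by
  obtain ⟨hc, hs⟩ := hX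
  refine ⟨∑' s : ℝ, (Module.finrank ℂ
    (Module.End.eigenspace (CFC.abs X : H →L[ℂ] H).toLinearMap (s : ℂ)) : ℝ) * s,
    fun ι _ e f he hf => ?_⟩
  choose w hw hwf using fun i => hc.exists_hasSum_eigenspace_cfcAbs (f i)
  have hlim : Tendsto (fun t : Finset ℝ => ∑ i, ‖⟪e i, X (∑ s ∈ t, w i s)⟫_ℂ‖) atTop
      (𝓝 (∑ i, ‖⟪e i, X (f i)⟫_ℂ‖)) :=
    tendsto_finsetSum _ fun i _ =>
      (tendsto_const_nhds.inner ((X.continuous.tendsto _).comp (hwf i))).norm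
  refine le_of_tendsto hlim (Eventually.of_forall fun t => ?_)
  refine le_trans ?_ (hs.sum_le_tsum t fun s _ => finrank_eigenspace_cfcAbs_mul_nonneg X s)
  have hterm (s : ℝ) : ∑ i, ‖⟪e i, X (w i s)⟫_ℂ‖ ≤ (Module.finrank ℂ
      (Module.End.eigenspace (CFC.abs X : H →L[ℂ] H).toLinearMap (s : ℂ)) : ℝ) * s := by
    rcases lt_trichotomy s 0 with hs0 | rfl | hs0
    · have hz (i) : w i s = 0 := by
        simpa [eigenspace_cfcAbs_eq_bot_of_neg X hs0] using hw i s
      simpa [hz] using finrank_eigenspace_cfcAbs_mul_nonneg X s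
    · have hz (i) : X (w i 0) = 0 := by
        simpa using norm_apply_of_mem_eigenspace_cfcAbs le_rfl (hw i 0)
      simp [hz]
    · have := ContinuousLinearMap.finite_dimensional_eigenspace hc.cfcAbs (s : ℂ)
        (by exact_mod_cast hs0.ne')
      set b := stdOrthonormalBasis ℂ
        (Module.End.eigenspace (CFC.abs X : H →L[ℂ] H).toLinearMap (s : ℂ))
      -- only the component of `f i` at `s` pairs with the eigenvectors at `s`
      have hcomp (i j) : ⟪(b j : H), w i s⟫_ℂ = ⟪(b j : H), f i⟫_ℂ := by
        have hsum := (hwf i).mapL (innerSL ℂ (b j : H))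
        refine (hasSum_single s fun s' hs' => ?_).unique hsum
        exact (orthogonalFamily_eigenspace_cfcAbs X) hs'.symm (b j) ⟨w i s', hw i s'⟩
      have hexp (i) : w i s = ∑ j, ⟪(b j : H), f i⟫_ℂ • (b j : H) := by
        have := congrArg Subtype.val (b.sum_repr' ⟨w i s, hw i s⟩)
        simpa [hcomp] using this.symm
      calc ∑ i, ‖⟪e i, X (w i s)⟫_ℂ‖
          ≤ ∑ i, ∑ j, ‖⟪f i, (b j : H)⟫_ℂ‖ * ‖⟪e i, X (b j)⟫_ℂ‖ := by
            gcongr with i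
            rw [hexp i, map_sum, inner_sum]
            refine (norm_sum_le _ _).trans (Finset.sum_le_sum fun j _ => ?_)
            rw [map_smul, inner_smul_right, norm_mul, norm_inner_symm]
        _ = ∑ j, ∑ i, ‖⟪f i, (b j : H)⟫_ℂ‖ * ‖⟪e i, X (b j)⟫_ℂ‖ := Finset.sum_comm
        _ ≤ ∑ j, ‖(b j : H)‖ * ‖X (b j)‖ :=
            Finset.sum_le_sum fun j _ => hf.sum_norm_inner_mul_norm_inner_le he _ _
        _ = _ := by
            have hb (j) : ‖(b j : H)‖ = 1 := b.orthonormal.1 j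
            simp [norm_apply_of_mem_eigenspace_cfcAbs hs0.le (b _).2, hb]
  calc ∑ i, ‖⟪e i, X (∑ s ∈ t, w i s)⟫_ℂ‖ ≤ ∑ i, ∑ s ∈ t, ‖⟪e i, X (w i s)⟫_ℂ‖ := by
        gcongr with i
        rw [map_sum, inner_sum]
        exact norm_sum_le _ _
    _ = ∑ s ∈ t, ∑ i, ‖⟪e i, X (w i s)⟫_ℂ‖ := Finset.sum_comm
    _ ≤ _ := Finset.sum_le_sum fun s _ => hterm s

/-- Away from compact operators, orthonormal families with uniformly large matrix entries can be
prolonged: subtracting the finite-rank part carried by the families built so far leaves an operator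
of norm at least `ε`. -/
lemma exists_orthonormal_of_not_isCompactOperator {X : H →L[ℂ] H} (hX : ¬ IsCompactOperator X) :
    ∃ ε > 0, ∀ n : ℕ, ∃ e f : Fin n → H, Orthonormal ℂ e ∧ Orthonormal ℂ f ∧
      ∀ i, ε ≤ ‖⟪e i, X (f i)⟫_ℂ‖ := by
  obtain ⟨ε, hε, hball⟩ := Metric.isOpen_iff.1 (isClosed_setOfPred_isCompactOperator
    (σ₁₂ := RingHom.id ℂ) (M₁ := H) (M₂ := H)).isOpen_compl X hX
  refine ⟨ε / 2, half_pos hε, fun n => ?_⟩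
  induction n with
  | zero => exact ⟨Fin.elim0, Fin.elim0, by simp [Orthonormal], by simp [Orthonormal], by simp⟩
  | succ n ih =>
    obtain ⟨e, f, he, hf, hef⟩ := ih
    set E := Submodule.span ℂ (Set.range e)
    set F := Submodule.span ℂ (Set.range f)
    have : FiniteDimensional ℂ E := FiniteDimensional.span_of_finite ℂ (Set.finite_range e)
    have : FiniteDimensional ℂ F := FiniteDimensional.span_of_finite ℂ (Set.finite_range f)
    have hcpt (U : Submodule ℂ H) [FiniteDimensional ℂ U] : IsCompactOperator U.starProjection :=
      (isCompactOperator_of_locallyCompactSpace_dom U.orthogonalProjectionOnto).clm_comp U.subtypeL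
    set Y : H →L[ℂ] H := (1 - E.starProjection) * X * (1 - F.starProjection) with hY
    have hYX : IsCompactOperator (X - Y) := by
      have : X - Y = E.starProjection.comp (X.comp (1 - F.starProjection)) +
          X.comp F.starProjection := by
        ext x; simp [hY]; abel
      rw [this]
      exact ((hcpt E).comp_clm _).add ((hcpt F).clm_comp X)
    have hnorm : ε ≤ ‖Y‖ := by
      by_contra! hlt
      exact hball (by simpa [dist_eq_norm] using hlt) hYX
    obtain ⟨x, hx⟩ : ∃ x, ε / 2 * ‖x‖ < ‖Y x‖ := by
      by_contra! hle
      linarith [Y.opNorm_le_bound (half_pos hε).le hle]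
    set u := x - F.starProjection x with hu
    set v := X u - E.starProjection (X u) with hv
    have hYx : Y x = v := by simp [hY, hu, hv]
    have hux : ‖u‖ ≤ ‖x‖ := by
      have : Fᗮ.starProjection x = u := by simp [hu]
      exact this ▸ Fᗮ.norm_starProjection_apply_le x
    have hvpos : 0 < ‖v‖ := by rw [← hYx]; exact lt_of_le_of_lt (by positivity) hx
    have hupos : 0 < ‖u‖ := by
      rw [norm_pos_iff]; rintro h0; rw [hv, h0] at hvpos; simp at hvpos
    have huF : u ∈ Fᗮ := F.sub_starProjection_mem_orthogonal x
    have hvE : v ∈ Eᗮ := E.sub_starProjection_mem_orthogonal (X u)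
    have hcons {g : Fin n → H} (hg : Orthonormal ℂ g) {z : H} (hz : 0 < ‖z‖)
        (hzg : z ∈ (Submodule.span ℂ (Set.range g))ᗮ) :
        Orthonormal ℂ (Fin.cons ((‖z‖⁻¹ : ℂ) • z) g : Fin (n + 1) → H) := by
      have hzi (i) : ⟪g i, z⟫_ℂ = 0 := hzg _ (Submodule.subset_span ⟨i, rfl⟩)
      have hzi' (i) : ⟪z, g i⟫_ℂ = 0 := inner_eq_zero_symm.1 (hzi i)
      refine ⟨fun i => ?_, fun i j hij => ?_⟩
      · refine Fin.cases ?_ (fun i => ?_) i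
        · simp [norm_smul, hz.ne']
        · simpa using hg.1 i
      · induction i using Fin.cases <;> induction j using Fin.cases
        · exact absurd rfl hij
        · simp [inner_smul_left, hzi']
        · simp [inner_smul_right, hzi]
        · simpa using hg.2 (by simpa using hij)
    refine ⟨_, _, hcons he hvpos hvE, hcons hf hupos huF, fun i => ?_⟩
    refine Fin.cases ?_ (fun i => by simpa using hef i) i
    have hin : ⟪v, X u⟫_ℂ = (‖v‖ : ℂ) ^ 2 := by
      have h0 : ⟪v, E.starProjection (X u)⟫_ℂ = 0 :=
        (Submodule.mem_orthogonal' _ _).1 hvE _ (E.starProjection_apply_mem _)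
      have hXu : X u = v + E.starProjection (X u) := (sub_add_cancel _ _).symm
      rw [hXu, inner_add_right, h0, add_zero]
      exact inner_self_eq_norm_sq_to_K v
    simp only [Fin.cons_zero, map_smul, inner_smul_left, inner_smul_right, hin, norm_mul]
    simp
    field_simp
    rw [hYx] at hx
    nlinarith

/-- An operator with a trace norm bound is trace class. On an orthonormal family of eigenvectors of
`|X|`, with eigenvalues `s > 0`, pairing with the orthonormal vectors `s⁻¹ • X x` recovers the
eigenvalues. -/
lemma HasTraceNormLE.isTraceClass {X : H →L[ℂ] H} {M : ℝ} (hX : HasTraceNormLE X M) :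
    IsTraceClass X := by
  have hc : IsCompactOperator X := by
    by_contra hc
    obtain ⟨ε, hε, h⟩ := exists_orthonormal_of_not_isCompactOperator hc
    obtain ⟨n, hn⟩ := exists_nat_gt (M / ε)
    obtain ⟨e, f, he, hf, hef⟩ := h n
    have h1 := hX (Fin n) e f he hf
    have h2 : ∑ _i : Fin n, ε ≤ ∑ i, ‖⟪e i, X (f i)⟫_ℂ‖ := Finset.sum_le_sum fun i _ => hef i
    rw [div_lt_iff₀ hε] at hn
    simp only [Finset.sum_const, Finset.card_univ, Fintype.card_fin, nsmul_eq_mul] at h2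
    linarith
  refine ⟨hc, summable_of_sum_le (c := M) (finrank_eigenspace_cfcAbs_mul_nonneg X) fun t => ?_⟩
  have hfin (s : {s // s ∈ t.filter fun s => 0 < s}) : FiniteDimensional ℂ
      (Module.End.eigenspace (CFC.abs X : H →L[ℂ] H).toLinearMap ((s : ℝ) : ℂ)) :=
    ContinuousLinearMap.finite_dimensional_eigenspace hc.cfcAbs _
      (by exact_mod_cast (Finset.mem_filter.1 s.2).2.ne')
  let b (s : {s // s ∈ t.filter fun s => 0 < s}) := stdOrthonormalBasis ℂ
    (Module.End.eigenspace (CFC.abs X : H →L[ℂ] H).toLinearMap ((s : ℝ) : ℂ))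
  have hpos (s : {s // s ∈ t.filter fun s => 0 < s}) : (0 : ℝ) < s := (Finset.mem_filter.1 s.2).2
  let v (a : Σ s : {s // s ∈ t.filter fun s => 0 < s}, Fin (Module.finrank ℂ
    (Module.End.eigenspace (CFC.abs X : H →L[ℂ] H).toLinearMap ((s : ℝ) : ℂ)))) : H := b a.1 a.2
  have hv : Orthonormal ℂ v :=
    ((orthogonalFamily_eigenspace_cfcAbs X).comp
      Subtype.val_injective).orthonormal_sigma_orthonormal fun s => (b s).orthonormal
  have hXv (a a') : ⟪X (v a), X (v a')⟫_ℂ = (a.1 : ℝ) * ((a'.1 : ℝ) * ⟪v a, v a'⟫_ℂ) := by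
    have h (a) : (CFC.abs X : H →L[ℂ] H) (v a) = ((a.1 : ℝ) : ℂ) • v a :=
      Module.End.mem_eigenspace_iff.1 (b a.1 a.2).2
    rw [← inner_cfcAbs_apply_cfcAbs_apply, h, h, inner_smul_left, inner_smul_right,
      Complex.conj_ofReal]
  have hne (a : Σ s : {s // s ∈ t.filter fun s => 0 < s}, Fin (Module.finrank ℂ
      (Module.End.eigenspace (CFC.abs X : H →L[ℂ] H).toLinearMap ((s : ℝ) : ℂ)))) :
      ((a.1 : ℝ) : ℂ) ≠ 0 := by exact_mod_cast (hpos a.1).ne'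
  have hg : Orthonormal ℂ fun a => (((a.1 : ℝ) : ℂ))⁻¹ • X (v a) := by
    classical
    rw [orthonormal_iff_ite]
    intro a a'
    rw [inner_smul_left, inner_smul_right, hXv, orthonormal_iff_ite.1 hv, ← Complex.ofReal_inv,
      Complex.conj_ofReal, Complex.ofReal_inv]
    have := hne a
    have := hne a'
    split_ifs with h
    · field_simp
    · simp
  have hdiag (a) : ‖⟪(((a.1 : ℝ) : ℂ))⁻¹ • X (v a), X (v a)⟫_ℂ‖ = (a.1 : ℝ) := by
    have h1 : ⟪v a, v a⟫_ℂ = 1 := by simp [inner_self_eq_norm_sq_to_K, hv.1 a]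
    rw [inner_smul_left, hXv, h1, ← Complex.ofReal_inv, Complex.conj_ofReal, Complex.ofReal_inv,
      mul_one, inv_mul_cancel_left₀ (hne a), Complex.norm_real, Real.norm_of_nonneg (hpos a.1).le]
  have hsum := hX _ _ _ hg hv
  simp_rw [hdiag] at hsum
  rw [Fintype.sum_sigma] at hsum
  simp only [Finset.sum_const, Finset.card_univ, Fintype.card_fin, nsmul_eq_mul] at hsum
  rw [Finset.sum_coe_sort (t.filter fun s => 0 < s) fun s : ℝ => (Module.finrank ℂ
    (Module.End.eigenspace (CFC.abs X : H →L[ℂ] H).toLinearMap (s : ℂ)) : ℝ) * s,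
    Finset.sum_filter] at hsum
  refine le_trans (Finset.sum_le_sum fun s _ => ?_) hsum
  split_ifs with hs
  · exact le_rfl
  · exact mul_nonpos_of_nonneg_of_nonpos (Nat.cast_nonneg _) (not_lt.1 hs)


end TraceNorm

/-! ### Finite-dimensional invariant subspaces -/

section InvariantSubspace

variable {H : Type*} [NormedAddCommGroup H] [InnerProductSpace ℂ H]

/-- The span of `f, (S - μ) f, …, (S - μ)^(k-1) f` is invariant once `(S - μ)^k f = 0`. -/
lemma IsGeneralizedEigenvector.exists_finiteDimensional_invariant {S : H →L[ℂ] H} {f : H}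
    (hf : IsGeneralizedEigenvector S f) :
    ∃ F : Submodule ℂ H, FiniteDimensional ℂ F ∧ (∀ x ∈ F, S x ∈ F) ∧ f ∈ F := by
  obtain ⟨hf0, μ, k, hk⟩ := hf
  set N := S - μ • (1 : H →L[ℂ] H) with hN
  refine ⟨Submodule.span ℂ (Set.range fun i : Fin k => (N ^ (i : ℕ)) f),
    FiniteDimensional.span_of_finite ℂ (Set.finite_range _), fun x hx => ?_, ?_⟩
  · induction hx using Submodule.span_induction with
    | mem x hx =>
      obtain ⟨i, rfl⟩ := hx
      have hS : S ((N ^ (i : ℕ)) f) = (N ^ ((i : ℕ) + 1)) f + μ • (N ^ (i : ℕ)) f := by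
        rw [pow_succ', mul_apply_eq_comp, hN]
        simp
      dsimp only
      rw [hS]
      refine add_mem ?_ (Submodule.smul_mem _ _ (Submodule.subset_span ⟨i, rfl⟩))
      rcases (Nat.succ_le_iff.2 i.2).lt_or_eq with h | h
      · exact Submodule.subset_span ⟨⟨i + 1, h⟩, rfl⟩
      · have : (i : ℕ) + 1 = k := h
        rw [this, hk]
        exact zero_mem _
    | zero => simp
    | add x y _ _ hx hy => rw [map_add]; exact add_mem hx hy
    | smul c x _ hx => rw [map_smul]; exact Submodule.smul_mem _ _ hx
  · have hk0 : 0 < k := by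
      rcases Nat.eq_zero_or_pos k with rfl | h
      · exact absurd (by simpa using hk) hf0
      · exact h
    exact Submodule.subset_span ⟨⟨0, hk0⟩, by simp⟩

/-- Finite-dimensional subspaces invariant under `S`, directed by inclusion. -/
abbrev FiniteInvariantSubspace (S : H →L[ℂ] H) : Type _ :=
  {F : Submodule ℂ H // FiniteDimensional ℂ F ∧ ∀ x ∈ F, S x ∈ F}

lemma sup_mem_finiteInvariantSubspace {S : H →L[ℂ] H} {F G : Submodule ℂ H}
    (hF : FiniteDimensional ℂ F ∧ ∀ x ∈ F, S x ∈ F)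
    (hG : FiniteDimensional ℂ G ∧ ∀ x ∈ G, S x ∈ G) :
    FiniteDimensional ℂ (F ⊔ G : Submodule ℂ H) ∧ ∀ x ∈ F ⊔ G, S x ∈ F ⊔ G := by
  have := hF.1
  have := hG.1
  refine ⟨inferInstance, fun x hx => ?_⟩
  obtain ⟨y, hy, z, hz, rfl⟩ := Submodule.mem_sup.1 hx
  rw [map_add]
  exact Submodule.add_mem_sup (hF.2 y hy) (hG.2 z hz)

lemma finiteInvariantSubspace_directed (S : H →L[ℂ] H) :
    IsDirectedOrder (FiniteInvariantSubspace S) :=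
  ⟨fun F G => ⟨⟨F.1 ⊔ G.1, sup_mem_finiteInvariantSubspace F.2 G.2⟩, le_sup_left (a := F.1),
    le_sup_right (a := F.1)⟩⟩

lemma topologicalClosure_iSup_finiteInvariantSubspace {S : H →L[ℂ] H}
    (hS : (Submodule.span ℂ {f | IsGeneralizedEigenvector S f}).topologicalClosure = ⊤) :
    ⊤ ≤ (⨆ F : FiniteInvariantSubspace S, F.1).topologicalClosure := by
  rw [← hS]
  refine Submodule.topologicalClosure_mono (Submodule.span_le.2 fun f hf => ?_)
  obtain ⟨F, hF, hSF, hfF⟩ := IsGeneralizedEigenvector.exists_finiteDimensional_invariant hf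
  exact le_iSup (fun F : FiniteInvariantSubspace S => F.1) ⟨F, hF, hSF⟩ hfF

/-- Parseval's identity and Bessel's inequality: on a finite-dimensional invariant subspace, `S`
has no larger Hilbert-Schmidt norm than the restriction of `S*` to it. -/
lemma sum_re_inner_selfCommutator_nonpos [CompleteSpace H] {S : H →L[ℂ] H} {F : Submodule ℂ H}
    (hF : ∀ x ∈ F, S x ∈ F) {ι : Type*} [Fintype ι] (u : OrthonormalBasis ι ℂ F) :
    ∑ j, (⟪selfCommutator S (u j), (u j : H)⟫_ℂ).re ≤ 0 := by
  have hu : Orthonormal ℂ fun j => (u j : H) := u.orthonormal.comp_linearIsometry F.subtypeₗᵢ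
  have hterm (j) : (⟪selfCommutator S (u j), (u j : H)⟫_ℂ).re =
      ‖S (u j)‖ ^ 2 - ‖ContinuousLinearMap.adjoint S (u j)‖ ^ 2 := by
    rw [selfCommutator, sub_apply, inner_sub_left, mul_apply_eq_comp,
      mul_apply_eq_comp, ContinuousLinearMap.adjoint_inner_left,
      ← ContinuousLinearMap.adjoint_inner_right S (ContinuousLinearMap.adjoint S (u j)),
      Complex.sub_re]
    exact congrArg₂ _ (inner_self_eq_norm_sq (𝕜 := ℂ) _) (inner_self_eq_norm_sq (𝕜 := ℂ) _)
  have hparseval (j) : ‖S (u j)‖ ^ 2 =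
      ∑ i, ‖⟪(u j : H), ContinuousLinearMap.adjoint S (u i)⟫_ℂ‖ ^ 2 := by
    rw [show ‖S (u j)‖ = ‖(⟨S (u j), hF _ (u j).2⟩ : F)‖ from rfl, ← u.sum_sq_norm_inner_right]
    refine Finset.sum_congr rfl fun i _ => ?_
    rw [ContinuousLinearMap.adjoint_inner_right, ← norm_inner_symm]
    rfl
  simp_rw [hterm, Finset.sum_sub_distrib, hparseval]
  rw [Finset.sum_comm, sub_nonpos]
  exact Finset.sum_le_sum fun i _ => hu.sum_inner_products_le _

/-- Compressing a positive operator `P` to a finite-dimensional subspace and diagonalizing the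
compression bounds its diagonal on any orthonormal family by its trace, taken in an orthonormal
basis of eigenvectors. -/
lemma ContinuousLinearMap.IsPositive.sum_re_inner_starProjection_le {P : H →L[ℂ] H}
    (hP : P.IsPositive) (F : Submodule ℂ H) [FiniteDimensional ℂ F] {M : ℝ}
    (hM : ∀ u : OrthonormalBasis (Fin (Module.finrank ℂ F)) ℂ F,
      ∑ j, (⟪P (u j), (u j : H)⟫_ℂ).re ≤ M)
    {ι : Type*} [Fintype ι] {e : ι → H} (he : Orthonormal ℂ e) :
    ∑ i, (⟪P (F.starProjection (e i)), F.starProjection (e i)⟫_ℂ).re ≤ M := by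
  set A : F →L[ℂ] F := F.orthogonalProjectionOnto ∘L P ∘L F.subtypeL with hA
  have hApos : A.IsPositive := hP.orthogonalProjectionOnto_comp F
  have hAP (v w : F) : ⟪A v, w⟫_ℂ = ⟪P v, (w : H)⟫_ℂ := by
    simp [hA]
  set u := hApos.isSymmetric.eigenvectorBasis rfl
  set l := hApos.isSymmetric.eigenvalues rfl
  have hAu (j) : A (u j) = (l j : ℂ) • u j := hApos.isSymmetric.apply_eigenvectorBasis rfl j
  have hl (j) : (⟪P (u j), (u j : H)⟫_ℂ).re = l j := by
    rw [← hAP, hAu, inner_smul_left, inner_self_eq_norm_sq_to_K, u.orthonormal.1]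
    simp
  have hl0 (j) : 0 ≤ l j := hl j ▸ hP.re_inner_nonneg_left _
  have hdiag (v : F) : (⟪P v, (v : H)⟫_ℂ).re = ∑ j, l j * ‖⟪u j, v⟫_ℂ‖ ^ 2 := by
    rw [← hAP, ← u.sum_inner_mul_inner, Complex.re_sum]
    refine Finset.sum_congr rfl fun j _ => ?_
    rw [hApos.inner_left_eq_inner_right, hAu, inner_smul_right, mul_assoc, Complex.re_ofReal_mul]
    congr 1
    refine (inner_mul_symm_re_eq_norm (𝕜 := ℂ) v (u j)).trans ?_
    rw [norm_mul, norm_inner_symm, sq]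
  calc ∑ i, (⟪P (F.starProjection (e i)), F.starProjection (e i)⟫_ℂ).re
      = ∑ i, ∑ j, l j * ‖⟪e i, (u j : H)⟫_ℂ‖ ^ 2 := by
        refine Finset.sum_congr rfl fun i _ => ?_
        refine (hdiag (F.orthogonalProjectionOnto (e i))).trans ?_
        refine Finset.sum_congr rfl fun j _ => ?_
        rw [Submodule.inner_orthogonalProjectionOnto_eq_of_mem_left, norm_inner_symm]
    _ = ∑ j, l j * ∑ i, ‖⟪e i, (u j : H)⟫_ℂ‖ ^ 2 := by
        rw [Finset.sum_comm]
        simp_rw [Finset.mul_sum]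
    _ ≤ ∑ j, l j * 1 := by
        gcongr with j
        · exact hl0 j
        · refine (he.sum_inner_products_le _).trans ?_
          have : ‖(u j : H)‖ = 1 := u.orthonormal.1 j
          simp [this]
    _ ≤ M := by simpa [hl] using hM u

/-- If the generalized eigenvectors of `S` span a dense subspace and `[S*, S] = P + C` with `P`
positive and `C` of bounded trace norm, then the diagonal of `P` is controlled by `C` on every
finite-dimensional invariant subspace, hence everywhere by density. -/
lemma isTraceClass_selfCommutator_of_eq_add [CompleteSpace H] {S P C : H →L[ℂ] H} {M : ℝ}
    (hP : P.IsPositive) (hC : HasTraceNormLE C M) (hPC : selfCommutator S = P + C)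
    (hS : (Submodule.span ℂ {f | IsGeneralizedEigenvector S f}).topologicalClosure = ⊤) :
    IsTraceClass (selfCommutator S) := by
  rw [hPC]
  refine (HasTraceNormLE.add (hP.hasTraceNormLE (M := M) fun ι _ e he => ?_) hC).isTraceClass
  have := finiteInvariantSubspace_directed S
  have hfd (F : FiniteInvariantSubspace S) : FiniteDimensional ℂ F.1 := F.2.1
  have : Nonempty (FiniteInvariantSubspace S) := ⟨⊥, inferInstance, by simp⟩
  have hproj (x : H) := Submodule.starProjection_tendsto_self
    (fun F : FiniteInvariantSubspace S => F.1) (fun _ _ h => h) x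
    (topologicalClosure_iSup_finiteInvariantSubspace hS)
  have hlim : Tendsto (fun F : FiniteInvariantSubspace S =>
      ∑ i, (⟪P (F.1.starProjection (e i)), F.1.starProjection (e i)⟫_ℂ).re) atTop
      (𝓝 (∑ i, (⟪P (e i), e i⟫_ℂ).re)) :=
    tendsto_finsetSum _ fun i _ => (Complex.continuous_re.tendsto _).comp
      (((P.continuous.tendsto _).comp (hproj (e i))).inner (hproj (e i)))
  refine le_of_tendsto hlim (Eventually.of_forall fun F => ?_)
  refine hP.sum_re_inner_starProjection_le F.1 (fun u => ?_) he
  have hu : Orthonormal ℂ fun j => (u j : H) := u.orthonormal.comp_linearIsometry F.1.subtypeₗᵢ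
  have hcomm := sum_re_inner_selfCommutator_nonpos F.2.2 u
  have hCu : -∑ j, (⟪C (u j), (u j : H)⟫_ℂ).re ≤ M := by
    refine le_trans ?_ (hC _ _ _ hu hu)
    rw [← Finset.sum_neg_distrib]
    refine Finset.sum_le_sum fun j _ => ?_
    rw [norm_inner_symm]
    exact (neg_le_abs _).trans (Complex.abs_re_le_norm _)
  simp only [hPC, add_apply, inner_add_left, Complex.add_re, Finset.sum_add_distrib] at hcomm
  linarith

end InvariantSubspace

/-! ### Compression to an invariant subspace -/

section Compression

variable {H : Type*} [NormedAddCommGroup H] [InnerProductSpace ℂ H] [CompleteSpace H]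
  {V : Submodule ℂ H} [CompleteSpace V]

lemma HasTraceNormLE.compression {C : H →L[ℂ] H} {M : ℝ} (hC : HasTraceNormLE C M) :
    HasTraceNormLE (ContinuousLinearMap.adjoint V.subtypeL ∘L C ∘L V.subtypeL) M := by
  intro ι _ e f he hf
  simpa [ContinuousLinearMap.adjoint_inner_right] using hC ι _ _
    (he.comp_linearIsometry V.subtypeₗᵢ) (hf.comp_linearIsometry V.subtypeₗᵢ)

/-- The self-commutator of a restriction exceeds the compression of the self-commutator by the
positive operator `J* T (1 - J J*) T* J`, where `J` is the inclusion of the invariant subspace. -/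
lemma selfCommutator_restrict (T : H →L[ℂ] H) (hV : Set.MapsTo T V V) :
    selfCommutator (T.restrict hV) =
      ContinuousLinearMap.adjoint V.subtypeL ∘L selfCommutator T ∘L V.subtypeL +
        (ContinuousLinearMap.adjoint V.subtypeL ∘L T) ∘L Vᗮ.starProjection ∘L
          ContinuousLinearMap.adjoint (ContinuousLinearMap.adjoint V.subtypeL ∘L T) := by
  refine ContinuousLinearMap.ext fun x => ext_inner_left ℂ fun y => ?_
  have hadj (z : V) : ContinuousLinearMap.adjoint (T.restrict hV) z =
      V.orthogonalProjectionOnto (ContinuousLinearMap.adjoint T z) := by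
    refine ext_inner_left ℂ fun y => ?_
    rw [ContinuousLinearMap.adjoint_inner_right,
      Submodule.inner_orthogonalProjectionOnto_eq_of_mem_left,
      ContinuousLinearMap.adjoint_inner_right]
    rfl
  simp [selfCommutator, ContinuousLinearMap.adjoint_inner_right, inner_sub_right, hadj,
    ContinuousLinearMap.adjoint_comp]
  rfl

end Compression

theorem theorem0 {H : Type*} [NormedAddCommGroup H] [InnerProductSpace ℂ H] [CompleteSpace H]
    (T : H →L[ℂ] H) (hT : IsClassAOne T)
    (V : Submodule ℂ H) [CompleteSpace V] (hV : Set.MapsTo T V V)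
    (hspan : (Submodule.span ℂ
      {f : V | IsGeneralizedEigenvector (T.restrict hV) f}).topologicalClosure = ⊤) :
    IsTraceClass (selfCommutator (T.restrict hV)) := by
  obtain ⟨P, C, hP, hC, hPC⟩ := hT
  obtain ⟨M, hM⟩ := hC.exists_hasTraceNormLE
  have hproj : (Vᗮ.starProjection : H →L[ℂ] H).IsPositive := 
    .of_isStarProjection isStarProjection_starProjection
  refine isTraceClass_selfCommutator_of_eq_add ((hP.adjoint_conj V.subtypeL).add
    (hproj.conj_adjoint (ContinuousLinearMap.adjoint V.subtypeL ∘L T)))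
    hM.compression ?_ hspan
  rw [selfCommutator_restrict, hPC, ContinuousLinearMap.add_comp, ContinuousLinearMap.comp_add]
  abel
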